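/- For $n\ge 0$ let $S_n$ be the set of permutations $w=w(1)\cdots w(n)$ of $\{1,\dots,n\}$, with $S_0=\{\emptyset\}$. For $1\le i<n$ let $s_i$ be the transposition of $i$ and $i+1$, so that $ws_i$ is obtained from $w$ by swapping the entries $w(i)$ and $w(i+1)$. On $\mathbb{Z}[\beta][x_1,\dots,x_n]$ let $\partial_i f=(f-s_i\cdot f)/(x_i-x_{i+1})$, where $s_i\cdot f$ is $f$ with $x_i$ and $x_{i+1}$ interchanged, and let $\pi_i f=\partial_i\big((1+\beta x_{i+1})f\big)$. The $\beta$-Grothendieck polynomials $\mathfrak{G}^{(\beta)}_w(x)$, $w\in S_n$, are defined by $\mathfrak{G}^{(\beta)}_{w_0}(x)=x_1^{n-1}x_2^{n-2}\cdots x_{n-1}$ for $w_0=n\cdots 21$, and $\mathfrak{G}^{(\beta)}_w(x)=\pi_i\,\mathfrak{G}^{(\beta)}_{ws_i}(x)$ for any $i$ with $w(i)<w(i+1)$ (the result does not depend on the choice of $i$). Let $\Upsilon_w(\beta)=\mathfrak{G}^{(\beta)}_w(1,\dots,1)\in\mathbb{Z}[\beta]$. For $v\in S_m$ and $w\in S_n$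 let $p_v(w)$ be the number of choices of positions $1\le i_1<\cdots<i_m\le n$ such that $w(i_1)\cdots w(i_m)$ has the same relative order as $v(1)\cdots v(m)$; in particular $p_\emptyset(w)=1$. Define $c_w(\beta)\in\mathbb{Z}[\beta]$ recursively by $c_\emptyset(\beta)=1$ and, for $w\in S_n$ with $n\ge 1$, $$c_w(\beta)=\Upsilon_w(\beta)-\sum_{\substack{v\in S_m\\ 0\le m<n}}c_v(\beta)\,p_v(w).$$ **Inverse conservation principle.** For every $n\ge 0$ and every permutation $w\in S_n$, $c_w(\beta)=c_{w^{-1}}(\beta)$. -/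

import Mathlib

/-! Permutations `w ∈ S_n` are `w : Equiv.Perm (Fin n)`, so positions, values and the variables
`x_1, …, x_n` are indexed from `0`. The parameter `β` is `Polynomial.X : Polynomial ℤ`, and
`ℤ[β][x_1, …, x_n]` is `MvPolynomial (Fin n) (Polynomial ℤ)`. -/

namespace GrothendieckSpecialization

/-- `ℤ[β][x_1, …, x_n]`. -/
abbrev PolyRing (n : ℕ) : Type := MvPolynomial (Fin n) (Polynomial ℤ)

/-- The parameter `β`, as a constant of `ℤ[β][x_1, …, x_n]`. -/
noncomputable def beta (n : ℕ) : PolyRing n := MvPolynomial.C Polynomial.X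

/-- The action `w · f = f(x_{w(1)}, …, x_{w(n)})`. -/
noncomputable def act {n : ℕ} (w : Equiv.Perm (Fin n)) (f : PolyRing n) : PolyRing n :=
  MvPolynomial.rename w f

theorem X_sub_X_dvd {n : ℕ} (i j : Fin n) (f : PolyRing n) :
    (MvPolynomial.X i - MvPolynomial.X j : PolyRing n) ∣ f - act (Equiv.swap i j) f := by
  rw [← Ideal.mem_span_singleton, ← Ideal.Quotient.mk_eq_mk_iff_sub_mem]
  set I : Ideal (PolyRing n) := Ideal.span {MvPolynomial.X i - MvPolynomial.X j} with hI
  have hij : Ideal.Quotient.mk I (MvPolynomial.X i) = Ideal.Quotient.mk I (MvPolynomial.X j) := by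
    rw [Ideal.Quotient.mk_eq_mk_iff_sub_mem]
    exact Ideal.mem_span_singleton_self _
  have h : (Ideal.Quotient.mkₐ (Polynomial ℤ) I) =
      (Ideal.Quotient.mkₐ (Polynomial ℤ) I).comp (MvPolynomial.rename (Equiv.swap i j)) := by
    refine MvPolynomial.algHom_ext fun k => ?_
    simp only [AlgHom.comp_apply, MvPolynomial.rename_X, Ideal.Quotient.mkₐ_eq_mk]
    rw [Equiv.swap_apply_def]
    split_ifs with h1 h2
    · rw [h1, hij]
    · rw [h2, hij]
    · rfl
  exact DFunLike.congr_fun h f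

/-- The divided difference `(f - s · f) / (x_i - x_j)`, where `s` is the transposition of
`i ≠ j`; it is used for `j = i + 1`. -/
noncomputable def divDiff {n : ℕ} (i j : Fin n) (f : PolyRing n) : PolyRing n :=
  Classical.choose (X_sub_X_dvd i j f)

theorem divDiff_spec {n : ℕ} (i j : Fin n) (f : PolyRing n) :
    (MvPolynomial.X i - MvPolynomial.X j) * divDiff i j f = f - act (Equiv.swap i j) f :=
  (Classical.choose_spec (X_sub_X_dvd i j f)).symm

/-- The operator `π_i = ∂_i (1 + β x_{i+1})`, with `j = i + 1`. -/
noncomputable def isobaric {n : ℕ} (i j : Fin n) (f : PolyRing n) : PolyRing n :=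
  divDiff i j ((1 + beta n * MvPolynomial.X j) * f)

/-- `i` is an ascent of `w`: `i` and `i + 1` are positions of `w` and `w(i) < w(i+1)`. -/
def IsAscent {n : ℕ} (w : Equiv.Perm (Fin n)) (i : ℕ) : Prop :=
  ∃ h : i + 1 < n, w ⟨i, Nat.lt_of_succ_lt h⟩ < w ⟨i + 1, h⟩

instance {n : ℕ} (w : Equiv.Perm (Fin n)) : DecidablePred (IsAscent w) := fun i =>
  inferInstanceAs (Decidable (∃ h : i + 1 < n, w ⟨i, Nat.lt_of_succ_lt h⟩ < w ⟨i + 1, h⟩))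

/-- The simple transposition `s_i` of `S_n` swapping `i` and `i + 1`. -/
def simpleSwap {n : ℕ} (i : ℕ) (h : i + 1 < n) : Equiv.Perm (Fin n) :=
  Equiv.swap ⟨i, Nat.lt_of_succ_lt h⟩ ⟨i + 1, h⟩

/-- Every `w` different from the longest permutation `w₀` has an ascent. -/
theorem exists_isAscent {n : ℕ} {w : Equiv.Perm (Fin n)} (hw : w ≠ Fin.revPerm) :
    ∃ i, IsAscent w i := by
  by_contra hno
  refine hw ?_
  cases n with
  | zero => exact Subsingleton.elim _ _
  | succ n =>
    have hanti : StrictAnti w := by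
      refine Fin.strictAnti_iff_succ_lt.2 fun i => ?_
      have h1 : ¬ w i.castSucc < w i.succ := fun h =>
        hno ⟨i, ⟨Nat.succ_lt_succ i.isLt, h⟩⟩
      refine lt_of_le_of_ne (not_lt.1 h1) fun h => ?_
      have := w.injective h
      simp [Fin.ext_iff] at this
    have hmono : StrictMono fun x => w (Fin.rev x) := fun a b hab => hanti (Fin.rev_lt_rev.2 hab)
    have hsurj : Function.Surjective fun x => w (Fin.rev x) :=
      w.surjective.comp Fin.rev_surjective
    ext x
    have hx := DFunLike.congr_fun (Subsingleton.elim (hmono.orderIsoOfSurjective _ hsurj)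
      (OrderIso.refl (Fin (n + 1)))) (Fin.rev x)
    simp only [StrictMono.coe_orderIsoOfSurjective, Fin.rev_rev, OrderIso.refl_apply] at hx
    rw [hx, Fin.revPerm_apply]

/-- The number of pairs of positions `a < b` with `w(a) < w(b)`, that is, `ℓ(w₀) - ℓ(w)`. -/
def colength {n : ℕ} (w : Equiv.Perm (Fin n)) : ℕ :=
  (Finset.univ.filter fun p : Fin n × Fin n => p.1 < p.2 ∧ w p.1 < w p.2).card

theorem colength_mul_simpleSwap_lt {n : ℕ} (w : Equiv.Perm (Fin n)) (i : ℕ) (h : i + 1 < n)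
    (hw : w ⟨i, Nat.lt_of_succ_lt h⟩ < w ⟨i + 1, h⟩) :
    colength (w * simpleSwap i h) < colength w := by
  set s := simpleSwap i h with hs
  unfold colength
  rw [← Finset.card_map (Equiv.prodCongr s s).toEmbedding]
  refine Finset.card_lt_card (Finset.ssubset_iff_subset_ne.2 ⟨?_, ?_⟩)
  · intro p hp
    obtain ⟨⟨a, b⟩, hab, rfl⟩ := Finset.mem_map.1 hp
    replace hab := (Finset.mem_filter.1 hab).2
    simp only [Equiv.Perm.mul_apply] at hab
    simp only [Finset.mem_filter, Finset.mem_univ, true_and, Equiv.coe_toEmbedding,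
      Equiv.prodCongr_apply, Prod.map_apply]
    refine ⟨?_, hab.2⟩
    obtain ⟨h1, h2⟩ := hab
    rw [hs, simpleSwap] at h2 ⊢
    simp only [Equiv.swap_apply_def, Fin.ext_iff, Fin.lt_def] at h1 h2 ⊢
    split_ifs at h2 ⊢ <;> simp_all <;> omega
  · intro heq
    have hmem : ((⟨i, Nat.lt_of_succ_lt h⟩, ⟨i + 1, h⟩) : Fin n × Fin n) ∈
        (Finset.univ.filter fun p : Fin n × Fin n => p.1 < p.2 ∧ w p.1 < w p.2) := by
      simpa using hw
    rw [← heq] at hmem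
    obtain ⟨⟨a, b⟩, hab, he⟩ := Finset.mem_map.1 hmem
    replace hab := (Finset.mem_filter.1 hab).2.1
    simp only [Equiv.coe_toEmbedding, Equiv.prodCongr_apply, Prod.map_apply, Prod.mk.injEq] at he
    have ha : a = ⟨i + 1, h⟩ := by
      rw [← s.symm_apply_eq.2 he.1.symm, hs, simpleSwap]; simp
    have hb : b = ⟨i, Nat.lt_of_succ_lt h⟩ := by
      rw [← s.symm_apply_eq.2 he.2.symm, hs, simpleSwap]; simp
    rw [ha, hb] at hab
    exact absurd hab (by simp)

/-- The `β`-Grothendieck polynomial `𝔊_w`: it is `x_1^{n-1} x_2^{n-2} ⋯ x_{n-1}` for `w = w₀`,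
and `π_i 𝔊_{w s_i}` with `i` the first ascent of `w` otherwise. The theorem
`grothendieck_of_isAscent` shows that every other ascent gives the same polynomial. -/
noncomputable def grothendieck {n : ℕ} (w : Equiv.Perm (Fin n)) : PolyRing n :=
  if hw : w = Fin.revPerm then
    ∏ i : Fin n, MvPolynomial.X i ^ (n - 1 - (i : ℕ))
  else
    isobaric ⟨Nat.find (exists_isAscent hw),
        Nat.lt_of_succ_lt (Nat.find_spec (exists_isAscent hw)).choose⟩
      ⟨Nat.find (exists_isAscent hw) + 1, (Nat.find_spec (exists_isAscent hw)).choose⟩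
      (grothendieck (w * simpleSwap (Nat.find (exists_isAscent hw))
        (Nat.find_spec (exists_isAscent hw)).choose))
termination_by colength w
decreasing_by
  exact colength_mul_simpleSwap_lt w _ _ (Nat.find_spec (exists_isAscent hw)).choose_spec

section WellDefined

open MvPolynomial

variable {n : ℕ}

theorem act_act (u v : Equiv.Perm (Fin n)) (f : PolyRing n) : act u (act v f) = act (u * v) f := by
  simp [act, MvPolynomial.rename_rename, Equiv.Perm.coe_mul]

theorem isobaric_spec (i j : Fin n) (f : PolyRing n) :
    (X i - X j) * isobaric i j f =
      (1 + beta n * X j) * f - (1 + beta n * X i) * act (Equiv.swap i j) f := by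
  rw [isobaric, divDiff_spec]
  simp [act, beta]

theorem act_isobaric_spec (u : Equiv.Perm (Fin n)) (i j : Fin n) (f : PolyRing n) :
    (X (u i) - X (u j)) * act u (isobaric i j f) =
      (1 + beta n * X (u j)) * act u f -
        (1 + beta n * X (u i)) * act (u * Equiv.swap i j) f := by
  have h := congrArg (act u) (isobaric_spec i j f)
  rw [← act_act]
  simpa [act, beta] using h

theorem X_sub_X_ne {i j : Fin n} (h : i ≠ j) : (X i - X j : PolyRing n) ≠ 0 :=
  sub_ne_zero.2 fun he => h (X_injective he)

theorem act_swap_isobaric {i j : Fin n} (h : i ≠ j) (f : PolyRing n) :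
    act (Equiv.swap i j) (isobaric i j f) = isobaric i j f := by
  refine mul_left_cancel₀ (X_sub_X_ne h.symm) ?_
  have h1 := act_isobaric_spec (Equiv.swap i j) i j f
  have h2 := isobaric_spec i j f
  have h3 : act (1 : Equiv.Perm (Fin n)) f = f := by simp [act]
  rw [Equiv.swap_mul_self, h3, Equiv.swap_apply_left, Equiv.swap_apply_right] at h1
  linear_combination h1 + h2

/-- `π_i π_k = π_k π_i` for `|i - k| > 1`. -/
theorem isobaric_comm {i j k l : Fin n} (hij : i ≠ j) (hkl : k ≠ l) (hik : i ≠ k) (hil : i ≠ l)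
    (hjk : j ≠ k) (hjl : j ≠ l) (f : PolyRing n) :
    isobaric i j (isobaric k l f) = isobaric k l (isobaric i j f) := by
  refine mul_left_cancel₀ (X_sub_X_ne hij) (mul_left_cancel₀ (X_sub_X_ne hkl) ?_)
  have hc : Equiv.swap k l * Equiv.swap i j = Equiv.swap i j * Equiv.swap k l :=
    (Equiv.Perm.disjoint_swap_swap (by simp; grind)).commute
  have a1 := isobaric_spec i j (isobaric k l f)
  have a2 := isobaric_spec k l f
  have a3 := act_isobaric_spec (Equiv.swap i j) k l f
  have b1 := isobaric_spec k l (isobaric i j f)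
  have b2 := isobaric_spec i j f
  have b3 := act_isobaric_spec (Equiv.swap k l) i j f
  rw [Equiv.swap_apply_of_ne_of_ne hik.symm hjk.symm,
    Equiv.swap_apply_of_ne_of_ne hil.symm hjl.symm] at a3
  rw [Equiv.swap_apply_of_ne_of_ne hik hil, Equiv.swap_apply_of_ne_of_ne hjk hjl, hc] at b3
  linear_combination (X k - X l) * a1 - (X i - X j) * b1 + (1 + beta n * X j) * a2
    - (1 + beta n * X i) * a3 - (1 + beta n * X l) * b2 + (1 + beta n * X k) * b3

/-- `π_i π_{i+1} π_i = π_{i+1} π_i π_{i+1}`. -/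
theorem isobaric_braid {a b c : Fin n} (hab : a ≠ b) (hbc : b ≠ c) (hac : a ≠ c)
    (f : PolyRing n) :
    isobaric a b (isobaric b c (isobaric a b f)) =
      isobaric b c (isobaric a b (isobaric b c f)) := by
  refine mul_left_cancel₀ (X_sub_X_ne hab) (mul_left_cancel₀ (X_sub_X_ne hbc)
    (mul_left_cancel₀ (X_sub_X_ne hac) ?_))
  set s := Equiv.swap a b with hs
  set t := Equiv.swap b c with ht
  have sa : s a = b := by simp [hs]
  have sb : s b = a := by simp [hs]
  have sc : s c = c := Equiv.swap_apply_of_ne_of_ne hac.symm hbc.symm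
  have ta : t a = a := Equiv.swap_apply_of_ne_of_ne hab hac
  have tb : t b = c := by simp [ht]
  have tc : t c = b := by simp [ht]
  have hbraid : t * s * t = s * t * s := by
    ext x
    simp only [Equiv.Perm.mul_apply]
    by_cases hxa : x = a
    · subst hxa; simp [sa, sc, ta, tb]
    by_cases hxb : x = b
    · subst hxb; simp [sa, sb, sc, ta, tb, tc]
    by_cases hxc : x = c
    · subst hxc; simp [sb, sc, ta, tc]
    have h1 : s x = x := Equiv.swap_apply_of_ne_of_ne hxa hxb
    have h2 : t x = x := Equiv.swap_apply_of_ne_of_ne hxb hxc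
    simp [h1, h2]
  have e1 := isobaric_spec a b f
  have e2 := act_isobaric_spec t a b f
  have e3 := act_isobaric_spec (s * t) a b f
  have e4 := isobaric_spec b c (isobaric a b f)
  have e5 := act_isobaric_spec s b c (isobaric a b f)
  have e6 := isobaric_spec a b (isobaric b c (isobaric a b f))
  have e7 := act_swap_isobaric hab f
  have g1 := isobaric_spec b c f
  have g2 := act_isobaric_spec s b c f
  have g3 := act_isobaric_spec (t * s) b c f
  have g4 := isobaric_spec a b (isobaric b c f)
  have g5 := act_isobaric_spec t a b (isobaric b c f)
  have g6 := isobaric_spec b c (isobaric a b (isobaric b c f))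
  have g7 := act_swap_isobaric hbc f
  simp only [← hs, ← ht, Equiv.Perm.mul_apply, sa, sb, sc, ta, tb, tc, hbraid]
    at e1 e2 e3 e4 e5 e6 e7 g1 g2 g3 g4 g5 g6 g7
  linear_combination (X a - X c) * (X b - X c) * e6 + (X a - X c) * (1 + beta n * X b) * e4
    - (X b - X c) * (1 + beta n * X a) * e5
    - (X b - X c) * (1 + beta n * X a) * (1 + beta n * X c) * e7
    + (1 + beta n * X c) ^ 2 * e1 - (1 + beta n * X b) ^ 2 * e2 + (1 + beta n * X a) ^ 2 * e3
    - ((X a - X b) * (X a - X c) * g6 + (X a - X c) * (1 + beta n * X c) * g4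
    - (X a - X b) * (1 + beta n * X b) * g5
    - (X a - X b) * (1 + beta n * X b) * (1 + beta n * X c) * g7
    + (1 + beta n * X b) * (1 + beta n * X c) * g1
    - (1 + beta n * X c) * (1 + beta n * X a) * g2
    + (1 + beta n * X b) * (1 + beta n * X a) * g3)

theorem grothendieck_of_isAscent_aux (N : ℕ) : ∀ (w : Equiv.Perm (Fin n)), colength w < N →
    ∀ (i : ℕ) (h : i + 1 < n), w ⟨i, Nat.lt_of_succ_lt h⟩ < w ⟨i + 1, h⟩ →
    grothendieck w = isobaric ⟨i, Nat.lt_of_succ_lt h⟩ ⟨i + 1, h⟩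
      (grothendieck (w * simpleSwap i h)) := by
  induction N with
  | zero => intro w hN; exact absurd hN (Nat.not_lt_zero _)
  | succ N ih =>
    intro w hN
    have key : ∀ (i k : ℕ) (hi : i + 1 < n) (hk : k + 1 < n), i < k →
        w ⟨i, Nat.lt_of_succ_lt hi⟩ < w ⟨i + 1, hi⟩ →
        w ⟨k, Nat.lt_of_succ_lt hk⟩ < w ⟨k + 1, hk⟩ →
        isobaric ⟨i, Nat.lt_of_succ_lt hi⟩ ⟨i + 1, hi⟩ (grothendieck (w * simpleSwap i hi)) =
        isobaric ⟨k, Nat.lt_of_succ_lt hk⟩ ⟨k + 1, hk⟩ (grothendieck (w * simpleSwap k hk)) := by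
      intro i k hi hk hik wi wk
      have ci := colength_mul_simpleSwap_lt w i hi wi
      have ck := colength_mul_simpleSwap_lt w k hk wk
      rcases Nat.lt_or_ge (i + 1) k with hlt | hge
      · have ai : (w * simpleSwap k hk) ⟨i, Nat.lt_of_succ_lt hi⟩ <
            (w * simpleSwap k hk) ⟨i + 1, hi⟩ := by
          rw [Equiv.Perm.mul_apply, Equiv.Perm.mul_apply, simpleSwap,
            Equiv.swap_apply_of_ne_of_ne (by simp; omega) (by simp; omega),
            Equiv.swap_apply_of_ne_of_ne (by simp; omega) (by simp; omega)]
          exact wi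
        have ak : (w * simpleSwap i hi) ⟨k, Nat.lt_of_succ_lt hk⟩ <
            (w * simpleSwap i hi) ⟨k + 1, hk⟩ := by
          rw [Equiv.Perm.mul_apply, Equiv.Perm.mul_apply, simpleSwap,
            Equiv.swap_apply_of_ne_of_ne (by simp; omega) (by simp; omega),
            Equiv.swap_apply_of_ne_of_ne (by simp; omega) (by simp; omega)]
          exact wk
        have hc : simpleSwap i hi * simpleSwap k hk = simpleSwap k hk * simpleSwap i hi :=
          (Equiv.Perm.disjoint_swap_swap (by simp; omega)).commute
        rw [ih _ (by omega) k hk ak, ih _ (by omega) i hi ai, mul_assoc, mul_assoc, hc]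
        exact isobaric_comm (by simp) (by simp) (by simp; omega) (by simp; omega)
          (by simp; omega) (by simp; omega) _
      · obtain rfl : k = i + 1 := by omega
        set A : Fin n := ⟨i, Nat.lt_of_succ_lt hi⟩ with hA
        set B : Fin n := ⟨i + 1, hi⟩ with hB
        set C : Fin n := ⟨i + 1 + 1, hk⟩ with hC
        have hab : A ≠ B := by simp [hA, hB]
        have hbc : B ≠ C := by simp [hB, hC]
        have hac : A ≠ C := by simp [hA, hC]; omega
        set s := simpleSwap i hi with hs
        set t := simpleSwap (i + 1) hk with ht
        have sa : s A = B := by simp [hs, simpleSwap, hA, hB]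
        have sb : s B = A := by simp [hs, simpleSwap, hA, hB]
        have sc : s C = C := Equiv.swap_apply_of_ne_of_ne hac.symm hbc.symm
        have ta : t A = A := Equiv.swap_apply_of_ne_of_ne hab hac
        have tb : t B = C := by simp [ht, simpleSwap, hC, hB]
        have tc : t C = B := by simp [ht, simpleSwap, hC, hB]
        have hbraid : w * s * t * s = w * t * s * t := by
          ext x
          simp only [Equiv.Perm.mul_apply]
          by_cases hxa : x = A
          · rw [hxa]; simp [sa, sc, ta, tb]
          by_cases hxb : x = B
          · rw [hxb]; simp [sa, sb, sc, ta, tb, tc]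
          by_cases hxc : x = C
          · rw [hxc]; simp [sb, sc, ta, tc]
          have h1 : s x = x := Equiv.swap_apply_of_ne_of_ne hxa hxb
          have h2 : t x = x := Equiv.swap_apply_of_ne_of_ne hxb hxc
          simp [h1, h2]
        have wt := wi.trans wk
        have p1 : (w * s) B < (w * s) C := by
          simpa only [Equiv.Perm.mul_apply, sb, sc] using wt
        have p2 : (w * s * t) A < (w * s * t) B := by
          simpa only [Equiv.Perm.mul_apply, sa, ta, tb, sc] using wk
        have q1 : (w * t) A < (w * t) B := by
          simpa only [Equiv.Perm.mul_apply, ta, tb] using wt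
        have q2 : (w * t * s) B < (w * t * s) C := by
          simpa only [Equiv.Perm.mul_apply, sb, sc, ta, tc] using wi
        have d1 := colength_mul_simpleSwap_lt (w * s) (i + 1) hk p1
        have d2 := colength_mul_simpleSwap_lt (w * t) i hi q1
        rw [← ht] at d1
        rw [← hs] at d2
        rw [ih (w * s) (by omega) (i + 1) hk p1, ih (w * s * t) (by omega) i hi p2,
          ih (w * t) (by omega) i hi q1, ih (w * t * s) (by omega) (i + 1) hk q2,
          ← hs, ← ht, hbraid]
        exact isobaric_braid hab hbc hac _
    intro i hi wi
    have hw : w ≠ Fin.revPerm := by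
      rintro rfl
      simp [Fin.lt_def] at wi
      omega
    rw [grothendieck, dif_neg hw]
    generalize_proofs h1 h2 h3
    obtain ⟨_, wk⟩ := Nat.find_spec (exists_isAscent hw)
    rcases lt_trichotomy i (Nat.find (exists_isAscent hw)) with hlt | heq | hgt
    · exact (key i _ hi h3 hlt wi wk).symm
    · subst heq; rfl
    · exact key _ i h3 hi hgt wk wi

/-- The recursion `𝔊_w = π_i 𝔊_{w s_i}` holds for every ascent `i` of `w`. -/
theorem grothendieck_of_isAscent (w : Equiv.Perm (Fin n)) (i : ℕ) (h : i + 1 < n)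
    (hw : w ⟨i, Nat.lt_of_succ_lt h⟩ < w ⟨i + 1, h⟩) :
    grothendieck w = isobaric ⟨i, Nat.lt_of_succ_lt h⟩ ⟨i + 1, h⟩
      (grothendieck (w * simpleSwap i h)) :=
  grothendieck_of_isAscent_aux _ w (Nat.lt_succ_self _) i h hw

end WellDefined

/-- The principal specialization `Υ_w(β) = 𝔊_w(1, …, 1) ∈ ℤ[β]`. -/
noncomputable def upsilon {n : ℕ} (w : Equiv.Perm (Fin n)) : Polynomial ℤ :=
  MvPolynomial.eval (fun _ => 1) (grothendieck w)

/-- `p_v(w)`: the number of choices `e` of positions `i_1 < ⋯ < i_m` such that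
`w(i_1), …, w(i_m)` has the same relative order as `v(1), …, v(m)`. -/
noncomputable def patternCount {m n : ℕ} (v : Equiv.Perm (Fin m)) (w : Equiv.Perm (Fin n)) : ℕ :=
  Nat.card {e : Fin m ↪o Fin n // ∀ a b : Fin m, v a < v b ↔ w (e a) < w (e b)}

/-- The polynomials `c_w(β) ∈ ℤ[β]`: `c_∅ = 1`, and for `w ∈ S_n` with `n ≥ 1`,
`c_w(β) = Υ_w(β) - ∑ c_v(β) p_v(w)`, the sum over all `v ∈ S_m` with `0 ≤ m < n`. -/
noncomputable def patternCoeff : {n : ℕ} → Equiv.Perm (Fin n) → Polynomial ℤ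
  | 0, _ => 1
  | n + 1, w => upsilon w -
      ∑ m : Fin (n + 1), ∑ v : Equiv.Perm (Fin m), patternCoeff v * (patternCount v w : Polynomial ℤ)
termination_by n => n
decreasing_by exact m.isLt

end GrothendieckSpecialization

/-!
Let `u_i` be the generators of the degenerate Hecke algebra, with `u_i ^ 2 = β u_i`, and put
`h_j(x) = 1 + x u_j`. By Fomin and Kirillov, `𝔊_w` is the coefficient of `w` in the staircase
product `⋯ (h_2(x_2) ⋯ h_{n-1}(x_2)) (h_1(x_1) ⋯ h_{n-1}(x_1))`: the Yang–Baxter relation makes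
two consecutive rows commute once they have the same length, and on coefficients this is the
recursion `𝔊_w = π_i 𝔊_{w s_i}`.

When all variables are equal, the staircase product read backwards is the same product decomposed
by diagonals instead of rows. So it is fixed by the anti-automorphism of the Hecke algebra that
fixes the generators and sends `w` to `w⁻¹`, whence `Υ_w = Υ_{w⁻¹}`. As the occurrences of `v` in
`w` correspond to those of `v⁻¹` in `w⁻¹`, the recursion gives `c_w = c_{w⁻¹}` by induction.

The coefficients are taken in functions on the permutations of `ℕ`, on which right and left
multiplication by the generators act as commuting operators; this avoids an algebra with basis
`S_n`.
-/

namespace GrothendieckSpecialization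

section Products

variable {A P : Type*} [Monoid A]

/-- The product `a_i a_{i+1} ⋯ a_{i+k-1}`, a row of a staircase product. -/
def ascProd (a : ℕ → A) (i : ℕ) : ℕ → A
  | 0 => 1
  | k + 1 => a i * ascProd a (i + 1) k

/-- The product `h_{i+k-1}(x_{k-1}) ⋯ h_{i+1}(x_1) h_i(x_0)`, a diagonal of a staircase product. -/
def diagProd (h : P → ℕ → A) (x : ℕ → P) (i : ℕ) : ℕ → A
  | 0 => 1
  | k + 1 => h (x k) (i + k) * diagProd h x i k

/-- The Fomin–Kirillov product, in which the row of length `k - 1 - r` has the parameter `x_r`: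
`⋯ (h_{i+1}(x_1) ⋯ h_{i+k-2}(x_1)) (h_i(x_0) h_{i+1}(x_0) ⋯ h_{i+k-2}(x_0))`. -/
def staircaseProd (h : P → ℕ → A) : (ℕ → P) → ℕ → ℕ → A
  | _, _, 0 => 1
  | x, i, k + 1 => staircaseProd h (x ∘ Nat.succ) (i + 1) k * ascProd (h (x 0)) i k

theorem diagProd_succ' (h : P → ℕ → A) (x : ℕ → P) (i k : ℕ) :
    diagProd h x i (k + 1) = diagProd h (x ∘ Nat.succ) (i + 1) k * h (x 0) i := by
  induction k with
  | zero => simp only [diagProd, add_zero, mul_one, one_mul]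
  | succ k ih =>
    rw [diagProd, ih, diagProd, mul_assoc, Function.comp_apply, Nat.succ_eq_add_one,
      add_right_comm i 1 k, add_assoc i k 1]

theorem ascProd_mem {N : Submonoid A} {a : ℕ → A} {i : ℕ} (ha : ∀ j, i ≤ j → a j ∈ N) (k : ℕ) :
    ascProd a i k ∈ N := by
  induction k generalizing i with
  | zero => exact N.one_mem
  | succ k ih => exact N.mul_mem (ha i le_rfl) (ih fun j hj => ha j (Nat.le_of_succ_le hj))

theorem diagProd_mem {N : Submonoid A} {h : P → ℕ → A} {i : ℕ} (hN : ∀ s j, i ≤ j → h s j ∈ N)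
    (x : ℕ → P) (k : ℕ) : diagProd h x i k ∈ N := by
  induction k with
  | zero => exact N.one_mem
  | succ k ih => exact N.mul_mem (hN _ _ (Nat.le_add_right i k)) ih

theorem staircaseProd_mem {N : Submonoid A} {h : P → ℕ → A} {i : ℕ}
    (hN : ∀ s j, i ≤ j → h s j ∈ N) (x : ℕ → P) (k : ℕ) : staircaseProd h x i k ∈ N := by
  induction k generalizing x i with
  | zero => exact N.one_mem
  | succ k ih =>
    exact N.mul_mem (ih (fun s j hj => hN s j (Nat.le_of_succ_le hj)) _)
      (ascProd_mem (hN (x 0)) k)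

theorem mem_centralizer_singleton {c a : A} : a ∈ Submonoid.centralizer {c} ↔ Commute c a := by
  simp only [Submonoid.mem_centralizer_iff, Set.mem_singleton_iff, forall_eq, Commute, SemiconjBy]

theorem commute_ascProd {c : A} {a : ℕ → A} {i : ℕ} (hc : ∀ j, i ≤ j → Commute c (a j)) (k : ℕ) :
    Commute c (ascProd a i k) :=
  mem_centralizer_singleton.1 (ascProd_mem (fun j hj => mem_centralizer_singleton.2 (hc j hj)) k)

theorem commute_diagProd {c : A} {h : P → ℕ → A} {i : ℕ} (hc : ∀ s j, i ≤ j → Commute c (h s j))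
    (x : ℕ → P) (k : ℕ) : Commute c (diagProd h x i k) :=
  mem_centralizer_singleton.1
    (diagProd_mem (fun s j hj => mem_centralizer_singleton.2 (hc s j hj)) x k)

theorem commute_staircaseProd {c : A} {h : P → ℕ → A} {i : ℕ}
    (hc : ∀ s j, i ≤ j → Commute c (h s j)) (x : ℕ → P) (k : ℕ) :
    Commute c (staircaseProd h x i k) :=
  mem_centralizer_singleton.1
    (staircaseProd_mem (fun s j hj => mem_centralizer_singleton.2 (hc s j hj)) x k)

/-- Peeling off the diagonal of first factors of the rows: each of them commutes with the shorter
rows to its left, apart from their own first factors. -/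
theorem staircaseProd_succ_eq_diagProd_mul {h : P → ℕ → A}
    (hc : ∀ s t i j, i + 1 < j → Commute (h s i) (h t j)) (x : ℕ → P) (i k : ℕ) :
    staircaseProd h x i (k + 1) = diagProd h x i k * staircaseProd h x (i + 1) k := by
  induction k generalizing x i with
  | zero => simp only [staircaseProd, diagProd, ascProd]
  | succ k ih =>
    have hcomm : Commute (h (x 0) i) (staircaseProd h (x ∘ Nat.succ) (i + 2) k) :=
      commute_staircaseProd (fun t j hj => hc _ t i j hj) _ k
    calc staircaseProd h x i (k + 2)
        = staircaseProd h (x ∘ Nat.succ) (i + 1) (k + 1) *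
            (h (x 0) i * ascProd (h (x 0)) (i + 1) k) := rfl
      _ = diagProd h (x ∘ Nat.succ) (i + 1) k *
            (staircaseProd h (x ∘ Nat.succ) (i + 2) k * h (x 0) i) *
              ascProd (h (x 0)) (i + 1) k := by rw [ih]; simp only [mul_assoc]
      _ = diagProd h (x ∘ Nat.succ) (i + 1) k * h (x 0) i *
            (staircaseProd h (x ∘ Nat.succ) (i + 2) k * ascProd (h (x 0)) (i + 1) k) := by
          rw [← hcomm.eq]; simp only [mul_assoc]
      _ = diagProd h x i (k + 1) * staircaseProd h x (i + 1) (k + 1) := by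
          rw [diagProd_succ']; rfl

end Products

section Endomorphisms

variable {R S M N P Q : Type*} [Semiring R] [Semiring S] [AddCommMonoid M] [AddCommMonoid N]
  [Module R M] [Module S N]

theorem semiconj_ascProd {Φ : M → N} {a : ℕ → Module.End R M} {b : ℕ → Module.End S N}
    (hΦ : ∀ j, Function.Semiconj Φ (a j) (b j)) (i k : ℕ) :
    Function.Semiconj Φ ⇑(ascProd a i k) ⇑(ascProd b i k) := by
  induction k generalizing i with
  | zero => exact fun _ => rfl
  | succ k ih => exact (hΦ i).comp_right (ih (i + 1))

theorem semiconj_staircaseProd {Φ : M → N} {φ : P → Q} {h : P → ℕ → Module.End R M}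
    {h' : Q → ℕ → Module.End S N} (hΦ : ∀ s j, Function.Semiconj Φ (h s j) (h' (φ s) j))
    (x : ℕ → P) (i k : ℕ) :
    Function.Semiconj Φ ⇑(staircaseProd h x i k) ⇑(staircaseProd h' (φ ∘ x) i k) := by
  induction k generalizing x i with
  | zero => exact fun _ => rfl
  | succ k ih => exact (ih (x ∘ Nat.succ) (i + 1)).comp_right (semiconj_ascProd (hΦ (x 0)) i k)

theorem ascProd_apply_eq_diagProd_apply {h h' : P → ℕ → Module.End R M} {t : P} {d : M}
    (hc : ∀ s i j, Commute (h t i) (h' s j)) (hd : ∀ i, h t i d = h' t i d) (i k : ℕ) :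
    ascProd (h t) i k d = diagProd h' (fun _ => t) i k d := by
  induction k generalizing i with
  | zero => rfl
  | succ k ih =>
    have hcomm : Commute (h t i) (diagProd h' (fun _ => t) (i + 1) k) :=
      commute_diagProd (fun s j _ => hc s i j) _ k
    calc ascProd (h t) i (k + 1) d = h t i (ascProd (h t) (i + 1) k d) := rfl
      _ = diagProd h' (fun _ => t) (i + 1) k (h t i d) := by
        rw [ih]; exact DFunLike.congr_fun hcomm.eq d
      _ = diagProd h' (fun _ => t) i (k + 1) d := by rw [hd, diagProd_succ']; rfl

/-- Moving the factors one by one from the left family to the right one reverses their order, and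
the reversed staircase is again a staircase, decomposed by diagonals instead of rows. -/
theorem staircaseProd_apply_eq_of_commute {h h' : P → ℕ → Module.End R M} {t : P} {d : M}
    (hc : ∀ s s' i j, Commute (h s i) (h' s' j))
    (hc' : ∀ s s' i j, i + 1 < j → Commute (h' s i) (h' s' j))
    (hd : ∀ i, h t i d = h' t i d) (i k : ℕ) :
    staircaseProd h (fun _ => t) i k d = staircaseProd h' (fun _ => t) i k d := by
  induction k generalizing i with
  | zero => rfl
  | succ k ih =>
    have hcomm : Commute (staircaseProd h (fun _ => t) (i + 1) k)
        (diagProd h' (fun _ => t) i k) :=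
      commute_diagProd (fun s' j _ => (commute_staircaseProd
        (fun s l _ => (hc s s' l j).symm) _ k).symm) _ k
    calc staircaseProd h (fun _ => t) i (k + 1) d
        = staircaseProd h (fun _ => t) (i + 1) k (ascProd (h t) i k d) := rfl
      _ = diagProd h' (fun _ => t) i k (staircaseProd h (fun _ => t) (i + 1) k d) := by
        rw [ascProd_apply_eq_diagProd_apply (hc t) hd]
        exact DFunLike.congr_fun hcomm.eq d
      _ = staircaseProd h' (fun _ => t) i (k + 1) d := by
        rw [ih, staircaseProd_succ_eq_diagProd_mul hc']; rfl

end Endomorphisms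

section Hecke

variable {R A : Type*} [CommRing R] [Ring A] [Algebra R A]

/-- The relations of the generators `u_i` of the degenerate Hecke algebra, on which the
Fomin–Kirillov construction rests. -/
structure HeckeRel (β : R) (u : ℕ → A) : Prop where
  sq : ∀ i, u i * u i = β • u i
  comm : ∀ i j, i + 1 < j → Commute (u i) (u j)
  braid : ∀ i, u i * u (i + 1) * u i = u (i + 1) * u i * u (i + 1)

/-- The factor `h_j(x) = 1 + x u_j` of the Fomin–Kirillov product. -/
def heckeFactor (u : ℕ → A) (x : R) (j : ℕ) : A := 1 + x • u j

theorem commute_heckeFactor {u v : ℕ → A} {i j : ℕ} (huv : Commute (u i) (v j)) (x y : R) :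
    Commute (heckeFactor u x i) (heckeFactor v y j) :=
  (Commute.one_left _).add_left
    ((Commute.one_right _).add_right ((huv.smul_right y).smul_left x))

/-- The element `T_i(x, y)`, symmetric in `x` and `y`, with
`h_i(x) h_{i+1}(x) h_i(y) = T_i(x, y) h_{i+1}(x)`. -/
def yangBaxterFactor (β : R) (u : ℕ → A) (x y : R) (i : ℕ) : A :=
  1 + (x + y + β * x * y) • u i + (x * y) • (u (i + 1) * u i - u i * u (i + 1))

theorem yangBaxterFactor_symm (β : R) (u : ℕ → A) (x y : R) (i : ℕ) :
    yangBaxterFactor β u x y i = yangBaxterFactor β u y x i := by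
  unfold yangBaxterFactor
  module

namespace HeckeRel

variable {β : R} {u : ℕ → A}

theorem heckeFactor_mul_heckeFactor_mul_heckeFactor (hu : HeckeRel β u) (x y : R) (i : ℕ) :
    heckeFactor u x i * heckeFactor u x (i + 1) * heckeFactor u y i =
      yangBaxterFactor β u x y i * heckeFactor u x (i + 1) := by
  have hsq : u i * u (i + 1) * u (i + 1) = β • (u i * u (i + 1)) := by
    rw [mul_assoc, hu.sq, mul_smul_comm]
  simp only [heckeFactor, yangBaxterFactor, mul_add, add_mul, mul_one, one_mul, sub_mul,
    smul_mul_assoc, mul_smul_comm, hu.sq i, hsq, hu.braid i]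
  module

theorem ascProd_mul_ascProd (hu : HeckeRel β u) (x y : R) (i k : ℕ) :
    ascProd (heckeFactor u x) i (k + 2) * ascProd (heckeFactor u y) i (k + 2) =
      yangBaxterFactor β u x y i * (ascProd (heckeFactor u x) (i + 1) (k + 1) *
        ascProd (heckeFactor u y) (i + 1) (k + 1)) := by
  have hcomm : Commute (heckeFactor u y i) (ascProd (heckeFactor u x) (i + 2) k) :=
    GrothendieckSpecialization.commute_ascProd
      (fun j hj => commute_heckeFactor (hu.comm i j hj) y x) k
  calc ascProd (heckeFactor u x) i (k + 2) * ascProd (heckeFactor u y) i (k + 2)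
      = heckeFactor u x i * heckeFactor u x (i + 1) *
          (ascProd (heckeFactor u x) (i + 2) k * heckeFactor u y i) *
          ascProd (heckeFactor u y) (i + 1) (k + 1) := by simp only [ascProd, mul_assoc]
    _ = (heckeFactor u x i * heckeFactor u x (i + 1) * heckeFactor u y i) *
          (ascProd (heckeFactor u x) (i + 2) k *
            ascProd (heckeFactor u y) (i + 1) (k + 1)) := by
        rw [← hcomm.eq]; simp only [mul_assoc]
    _ = yangBaxterFactor β u x y i * (ascProd (heckeFactor u x) (i + 1) (k + 1) *
          ascProd (heckeFactor u y) (i + 1) (k + 1)) := by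
        rw [hu.heckeFactor_mul_heckeFactor_mul_heckeFactor]; simp only [ascProd, mul_assoc]

theorem commute_ascProd (hu : HeckeRel β u) (x y : R) (i k : ℕ) :
    Commute (ascProd (heckeFactor u x) i k) (ascProd (heckeFactor u y) i k) := by
  induction k generalizing i with
  | zero => exact Commute.one_left _
  | succ k ih =>
    cases k with
    | zero =>
      simpa only [ascProd, mul_one] using commute_heckeFactor (Commute.refl (u i)) x y
    | succ k =>
      rw [Commute, SemiconjBy, hu.ascProd_mul_ascProd, hu.ascProd_mul_ascProd, (ih (i + 1)).eq,
        yangBaxterFactor_symm]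

theorem heckeFactor_mul_staircaseProd_two (hu : HeckeRel β u) (x : ℕ → R) (i k : ℕ) :
    heckeFactor u (x 1) i * staircaseProd (heckeFactor u) x i (k + 2) =
      staircaseProd (heckeFactor u) (x ∘ Nat.succ ∘ Nat.succ) (i + 2) k *
        (ascProd (heckeFactor u (x 1)) i (k + 1) * ascProd (heckeFactor u (x 0)) i (k + 1)) := by
  have hcomm : Commute (heckeFactor u (x 1) i)
      (staircaseProd (heckeFactor u) (x ∘ Nat.succ ∘ Nat.succ) (i + 2) k) :=
    commute_staircaseProd (fun t j hj => commute_heckeFactor (hu.comm i j hj) (x 1) t) _ k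
  calc heckeFactor u (x 1) i * staircaseProd (heckeFactor u) x i (k + 2)
      = heckeFactor u (x 1) i *
          (staircaseProd (heckeFactor u) (x ∘ Nat.succ ∘ Nat.succ) (i + 2) k *
            ascProd (heckeFactor u (x 1)) (i + 1) k * ascProd (heckeFactor u (x 0)) i (k + 1)) :=
        rfl
    _ = _ := by
        rw [← mul_assoc, ← mul_assoc, hcomm.eq]; simp only [ascProd, mul_assoc]

theorem heckeFactor_mul_staircaseProd (hu : HeckeRel β u) (x : ℕ → R) (i : ℕ) {j k : ℕ}
    (hjk : j + 1 < k) :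
    heckeFactor u (x (j + 1)) (i + j) * staircaseProd (heckeFactor u) x i k =
      heckeFactor u (x j) (i + j) *
        staircaseProd (heckeFactor u) (x ∘ Equiv.swap j (j + 1)) i k := by
  induction j generalizing x i k with
  | zero =>
    obtain ⟨k, rfl⟩ := Nat.exists_eq_add_of_lt hjk
    have hx : x ∘ Equiv.swap 0 1 ∘ Nat.succ ∘ Nat.succ = x ∘ Nat.succ ∘ Nat.succ := by
      funext r
      simp [Equiv.swap_apply_of_ne_of_ne]
    have hswap := hu.heckeFactor_mul_staircaseProd_two (x ∘ Equiv.swap 0 1) i k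
    simp only [Function.comp_assoc, Function.comp_apply, Equiv.swap_apply_left,
      Equiv.swap_apply_right, hx] at hswap
    rw [zero_add, add_zero, show 1 + k + 1 = k + 2 by omega, hswap,
      hu.heckeFactor_mul_staircaseProd_two, (hu.commute_ascProd _ _ i (k + 1)).eq]
  | succ j ih =>
    obtain ⟨k, rfl⟩ := Nat.exists_eq_succ_of_ne_zero (Nat.ne_zero_of_lt hjk)
    have hx : (x ∘ Equiv.swap (j + 1) (j + 2)) ∘ Nat.succ =
        (x ∘ Nat.succ) ∘ Equiv.swap j (j + 1) := by
      funext r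
      exact congrArg x (Nat.succ_injective.swap_apply j (j + 1) r)
    have hx0 : (x ∘ Equiv.swap (j + 1) (j + 2)) 0 = x 0 := by
      simp [Equiv.swap_apply_of_ne_of_ne]
    have hrow := ih (x ∘ Nat.succ) (i + 1) (Nat.succ_lt_succ_iff.1 hjk)
    rw [add_right_comm, add_assoc] at hrow
    rw [Nat.succ_eq_add_one, staircaseProd, staircaseProd, hx, hx0, ← mul_assoc, ← mul_assoc]
    exact congrArg (· * _) hrow

end HeckeRel

end Hecke

section CoefficientFunctions

variable (G R : Type*) [Group G] [Semiring R]

open Classical in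
/-- The coefficient function of `1`, the unit of an algebra with basis `G`. -/
noncomputable def deltaOne : G → R := fun w => if w = 1 then 1 else 0

/-- The inversion `w ↦ w⁻¹`, as an operator on coefficient functions: it realizes the
anti-automorphism of the Hecke algebra that fixes the generators. -/
def invEquiv : (G → R) ≃ₗ[R] (G → R) := LinearEquiv.funCongrLeft R R (Equiv.inv G)

theorem invEquiv_deltaOne : invEquiv G R (deltaOne G R) = deltaOne G R := by
  classical exact funext fun _ => if_congr inv_eq_one rfl rfl

end CoefficientFunctions

section Operators

variable {α : Type*} [LinearOrder α] {R : Type*} [CommRing R]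

/-- The operator `f ↦ f u` of right multiplication by the Hecke generator `u` of the transposition
of `a` and `b`, on coefficient functions: `f` stands for the formal sum `∑ f(w) w`, and
`w u = w s` if `w(a) < w(b)`, `w u = β w` otherwise. -/
def heckeOp (β : R) (a b : α) : Module.End R (Equiv.Perm α → R) where
  toFun f w := if w b < w a then f (w * Equiv.swap a b) + β * f w else 0
  map_add' f g := by
    funext w
    simp only [Pi.add_apply]
    split_ifs <;> ring
  map_smul' c f := by
    funext w
    simp only [Pi.smul_apply, smul_eq_mul, RingHom.id_apply]
    split_ifs <;> ring

theorem heckeOp_apply (β : R) (a b : α) (f : Equiv.Perm α → R) (w : Equiv.Perm α) :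
    heckeOp β a b f w = if w b < w a then f (w * Equiv.swap a b) + β * f w else 0 := rfl

theorem heckeOp_mul_self (β : R) (a b : α) :
    heckeOp β a b * heckeOp β a b = β • heckeOp β a b := by
  refine LinearMap.ext fun f => funext fun w => ?_
  simp only [Module.End.mul_apply, LinearMap.smul_apply, Pi.smul_apply, smul_eq_mul, heckeOp_apply,
    Equiv.Perm.mul_apply, Equiv.swap_apply_left, Equiv.swap_apply_right]
  by_cases h : w b < w a
  · simp [h, h.not_gt]
  · simp [h]

theorem commute_heckeOp (β : R) {a b c d : α} (hac : a ≠ c) (had : a ≠ d) (hbc : b ≠ c)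
    (hbd : b ≠ d) : Commute (heckeOp β a b) (heckeOp β c d) := by
  have hswap : Equiv.swap a b * Equiv.swap c d = Equiv.swap c d * Equiv.swap a b := by
    ext p
    simp only [Equiv.Perm.mul_apply, Equiv.swap_apply_def]
    grind
  refine LinearMap.ext fun f => funext fun w => ?_
  simp only [Module.End.mul_apply, heckeOp_apply, Equiv.Perm.mul_apply, mul_assoc, hswap,
    Equiv.swap_apply_of_ne_of_ne hac had, Equiv.swap_apply_of_ne_of_ne hbc hbd,
    Equiv.swap_apply_of_ne_of_ne hac.symm hbc.symm, Equiv.swap_apply_of_ne_of_ne had.symm hbd.symm]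
  split_ifs <;> ring

theorem heckeOp_braid (β : R) {a b c : α} (hab : a ≠ b) (hac : a ≠ c) (hbc : b ≠ c) :
    heckeOp β a b * heckeOp β b c * heckeOp β a b =
      heckeOp β b c * heckeOp β a b * heckeOp β b c := by
  refine LinearMap.ext fun f => funext fun w => ?_
  have hbraid : Equiv.swap a b * (Equiv.swap b c * Equiv.swap a b) =
      Equiv.swap b c * (Equiv.swap a b * Equiv.swap b c) := by
    rw [← mul_assoc, ← mul_assoc, Equiv.swap_mul_swap_mul_swap hab hac, Equiv.swap_comm a b,
      Equiv.swap_comm b c, Equiv.swap_mul_swap_mul_swap hbc.symm hac.symm, Equiv.swap_comm a c]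
  have hab' : w a ≠ w b := w.injective.ne hab
  have hac' : w a ≠ w c := w.injective.ne hac
  have hbc' : w b ≠ w c := w.injective.ne hbc
  simp only [Module.End.mul_apply, heckeOp_apply, Equiv.Perm.mul_apply, mul_assoc, hbraid,
    Equiv.swap_apply_left, Equiv.swap_apply_right, Equiv.swap_mul_self, mul_one,
    Equiv.swap_apply_of_ne_of_ne hac.symm hbc.symm, Equiv.swap_apply_of_ne_of_ne hab hac]
  rcases lt_or_gt_of_ne hab' with cmp_ab | cmp_ab <;>
    rcases lt_or_gt_of_ne hbc' with cmp_bc | cmp_bc <;>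
    rcases lt_or_gt_of_ne hac' with cmp_ac | cmp_ac <;>
    first
    | (exfalso; order)
    | (simp only [cmp_ab, cmp_bc, cmp_ac, cmp_ab.not_gt, cmp_bc.not_gt, cmp_ac.not_gt, if_true,
        if_false] <;> ring)

/-- Left multiplication by the Hecke generator of the transposition of `a` and `b`, obtained from
right multiplication by conjugation with the inversion. -/
def heckeOpLeft (β : R) (a b : α) : Module.End R (Equiv.Perm α → R) :=
  (invEquiv (Equiv.Perm α) R).conjRingEquiv (heckeOp β a b)

theorem heckeOpLeft_apply (β : R) (a b : α) (f : Equiv.Perm α → R) (w : Equiv.Perm α) :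
    heckeOpLeft β a b f w =
      if w⁻¹ b < w⁻¹ a then f (Equiv.swap a b * w) + β * f w else 0 := by
  change heckeOp β a b (fun v => f v⁻¹) w⁻¹ = _
  simp only [heckeOp_apply, mul_inv_rev, inv_inv, Equiv.swap_inv]

theorem semiconj_invEquiv_heckeOp (β : R) (a b : α) :
    Function.Semiconj (invEquiv (Equiv.Perm α) R) (heckeOp β a b) (heckeOpLeft β a b) := fun f => by
  simp [heckeOpLeft]

theorem swap_lt_swap_iff {c d p q : α} (hcd : c ⋖ d) (hpq : ¬ (p = c ∧ q = d))
    (hqp : ¬ (p = d ∧ q = c)) : Equiv.swap c d p < Equiv.swap c d q ↔ p < q := by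
  have hlt := hcd.lt
  have hc : ∀ r, r ≠ d → (c < r ↔ d < r) := fun r hrd =>
    ⟨fun h => (hcd.ge_of_gt h).lt_of_ne hrd.symm, hlt.trans⟩
  have hd : ∀ r, r ≠ c → (r < c ↔ r < d) := fun r hrc =>
    ⟨fun h => h.trans hlt, fun h => (hcd.le_of_lt h).lt_of_ne hrc⟩
  simp only [Equiv.swap_apply_def]
  grind

/-- Either `s w ≠ w t` for the two transpositions `s` and `t`, and multiplying on one side does not
affect the descent on the other, or `s w = w t`, and the two descents coincide. -/
theorem commute_heckeOp_heckeOpLeft (β : R) {a b c d : α} (hab : a ⋖ b) (hcd : c ⋖ d) :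
    Commute (heckeOp β a b) (heckeOpLeft β c d) := by
  refine LinearMap.ext fun f => funext fun w => ?_
  simp only [Module.End.mul_apply, heckeOp_apply, heckeOpLeft_apply, mul_inv_rev, Equiv.swap_inv,
    Equiv.Perm.mul_apply]
  by_cases hasc : w a = c ∧ w b = d
  · obtain ⟨rfl, rfl⟩ := hasc
    simp [hab.lt.not_gt, hcd.lt.not_gt]
  by_cases hdesc : w a = d ∧ w b = c
  · obtain ⟨rfl, rfl⟩ := hdesc
    have hswap : Equiv.swap (w b) (w a) * w = w * Equiv.swap a b := by
      rw [Equiv.mul_swap_eq_swap_mul, Equiv.swap_comm]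
    simp [hab.lt, hcd.lt, hab.lt.not_gt, hcd.lt.not_gt, hswap]
  have hright : Equiv.swap c d (w b) < Equiv.swap c d (w a) ↔ w b < w a :=
    swap_lt_swap_iff hcd (fun h => hdesc ⟨h.2, h.1⟩) (fun h => hasc ⟨h.2, h.1⟩)
  have hleft : Equiv.swap a b (w⁻¹ d) < Equiv.swap a b (w⁻¹ c) ↔ w⁻¹ d < w⁻¹ c := by
    refine swap_lt_swap_iff hab (fun h => hdesc ⟨?_, ?_⟩) (fun h => hasc ⟨?_, ?_⟩)
    exacts [(Equiv.Perm.inv_eq_iff_eq.1 h.1).symm, (Equiv.Perm.inv_eq_iff_eq.1 h.2).symm,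
      (Equiv.Perm.inv_eq_iff_eq.1 h.2).symm, (Equiv.Perm.inv_eq_iff_eq.1 h.1).symm]
  simp only [hright, hleft, mul_assoc]
  split_ifs <;> ring

theorem heckeOp_deltaOne (β : R) {a b : α} (hab : a < b) :
    heckeOp β a b (deltaOne (Equiv.Perm α) R) = heckeOpLeft β a b (deltaOne (Equiv.Perm α) R) := by
  funext w
  simp only [heckeOp_apply, heckeOpLeft_apply, deltaOne]
  by_cases hw : w = 1
  · simp [hw, hab.not_gt]
  by_cases hs : w = Equiv.swap a b
  · simp [hs, hab]
  · have hright : w * Equiv.swap a b ≠ 1 := by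
      rwa [Ne, mul_eq_one_iff_eq_inv, Equiv.swap_inv]
    have hleft : Equiv.swap a b * w ≠ 1 := mul_eq_one_comm.not.1 hright
    simp [hw, hright, hleft]

end Operators

section FominKirillov

variable {R S : Type*} [CommRing R] [CommRing S]

/-- The operator of right multiplication by the generator `u_i` of the Hecke algebra of the
permutations of `ℕ`. -/
abbrev simpleHeckeOp (β : R) (i : ℕ) : Module.End R (Equiv.Perm ℕ → R) := heckeOp β i (i + 1)

theorem heckeRel_simpleHeckeOp (β : R) : HeckeRel β (simpleHeckeOp β) where
  sq i := heckeOp_mul_self β i (i + 1)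
  comm i j hij := commute_heckeOp β (by omega) (by omega) (by omega) (by omega)
  braid i := heckeOp_braid β (by omega) (by omega) (by omega)

/-- The coefficient of `w` in the Fomin–Kirillov staircase product of the factors `1 + x_r u_j`. -/
noncomputable def fkCoeff (β : R) (x : ℕ → R) (i k : ℕ) : Equiv.Perm ℕ → R :=
  staircaseProd (heckeFactor (simpleHeckeOp β)) x i k (deltaOne (Equiv.Perm ℕ) R)

theorem heckeFactor_simpleHeckeOp_apply (β s : R) (j : ℕ) (f : Equiv.Perm ℕ → R)
    (w : Equiv.Perm ℕ) :
    heckeFactor (simpleHeckeOp β) s j f w =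
      f w + s * if w (j + 1) < w j then f (w * Equiv.swap j (j + 1)) + β * f w else 0 := rfl

theorem commute_heckeFactor_simpleHeckeOp (β s t : R) (i j : ℕ) (hij : i + 1 < j) :
    Commute (heckeFactor (simpleHeckeOp β) s i) (heckeFactor (simpleHeckeOp β) t j) :=
  commute_heckeFactor ((heckeRel_simpleHeckeOp β).comm i j hij) s t

theorem map_fkCoeff (φ : R →+* S) (β : R) (x : ℕ → R) (i k : ℕ) (w : Equiv.Perm ℕ) :
    φ (fkCoeff β x i k w) = fkCoeff (φ β) (φ ∘ x) i k w := by
  have hfactor (s : R) (j : ℕ) : Function.Semiconj (fun f => φ ∘ f)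
      ⇑(heckeFactor (simpleHeckeOp β) s j) ⇑(heckeFactor (simpleHeckeOp (φ β)) (φ s) j) :=
    fun f => by
      funext w
      simp only [Function.comp_apply, heckeFactor_simpleHeckeOp_apply, map_add, map_mul,
        apply_ite φ, map_zero]
  have hdelta : φ ∘ deltaOne (Equiv.Perm ℕ) R = deltaOne (Equiv.Perm ℕ) S := by
    funext w
    simp only [Function.comp_apply, deltaOne, apply_ite φ, map_one, map_zero]
  rw [fkCoeff, fkCoeff, ← hdelta]
  exact congrFun (semiconj_staircaseProd hfactor x i k (deltaOne (Equiv.Perm ℕ) R)) w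

theorem fkCoeff_inv (β t : R) (i k : ℕ) (w : Equiv.Perm ℕ) :
    fkCoeff β (fun _ => t) i k w⁻¹ = fkCoeff β (fun _ => t) i k w := by
  let left (j : ℕ) : Module.End R (Equiv.Perm ℕ → R) := heckeOpLeft β j (j + 1)
  have hinv (s : R) (j : ℕ) : Function.Semiconj (invEquiv (Equiv.Perm ℕ) R)
      ⇑(heckeFactor (simpleHeckeOp β) s j) ⇑(heckeFactor left s j) := fun f => by
    simp [heckeFactor, left, (semiconj_invEquiv_heckeOp β j (j + 1)).eq]
  have hleft_right (s s' : R) (i j : ℕ) :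
      Commute (heckeFactor left s i) (heckeFactor (simpleHeckeOp β) s' j) :=
    commute_heckeFactor (commute_heckeOp_heckeOpLeft β (Order.covBy_add_one j)
      (Order.covBy_add_one i)).symm s s'
  have hdelta (j : ℕ) : heckeFactor left t j (deltaOne (Equiv.Perm ℕ) R) =
      heckeFactor (simpleHeckeOp β) t j (deltaOne (Equiv.Perm ℕ) R) := by
    simp only [heckeFactor, left, LinearMap.add_apply, LinearMap.smul_apply,
      heckeOp_deltaOne β (Nat.lt_succ_self j)]
  calc fkCoeff β (fun _ => t) i k w⁻¹
      = invEquiv _ R (fkCoeff β (fun _ => t) i k) w := rfl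
    _ = staircaseProd (heckeFactor left) (fun _ => t) i k (deltaOne _ R) w := by
      rw [fkCoeff, (semiconj_staircaseProd (φ := id) hinv _ i k).eq, invEquiv_deltaOne]; rfl
    _ = fkCoeff β (fun _ => t) i k w := by
      rw [staircaseProd_apply_eq_of_commute hleft_right
        (commute_heckeFactor_simpleHeckeOp β) hdelta]; rfl

theorem sub_mul_fkCoeff (β : R) (x : ℕ → R) (i : ℕ) {j k : ℕ} (hjk : j + 1 < k)
    {w : Equiv.Perm ℕ} (hw : w (i + j) < w (i + j + 1)) :
    (x j - x (j + 1)) * fkCoeff β x i k w =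
      (1 + β * x (j + 1)) * fkCoeff β x i k (w * Equiv.swap (i + j) (i + j + 1)) -
      (1 + β * x j) * fkCoeff β (x ∘ Equiv.swap j (j + 1)) i k
        (w * Equiv.swap (i + j) (i + j + 1)) := by
  have hmul (v : Equiv.Perm ℕ) := congrFun (DFunLike.congr_fun
    ((heckeRel_simpleHeckeOp β).heckeFactor_mul_staircaseProd x i hjk)
    (deltaOne (Equiv.Perm ℕ) R)) v
  simp only [Module.End.mul_apply, heckeFactor_simpleHeckeOp_apply, ← fkCoeff.eq_1] at hmul
  have hascent := hmul w
  have hdescent := hmul (w * Equiv.swap (i + j) (i + j + 1))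
  simp only [if_neg hw.not_gt, mul_zero, add_zero] at hascent
  simp only [Equiv.Perm.mul_apply, Equiv.swap_apply_left, Equiv.swap_apply_right, if_pos hw,
    mul_assoc, Equiv.swap_mul_self, mul_one] at hdescent
  linear_combination x j * hascent - hdescent

theorem fkCoeff_eq_zero_of_apply_ne (β : R) (x : ℕ → R) {p i : ℕ} (hp : p < i) (k : ℕ)
    {w : Equiv.Perm ℕ} (hw : w p ≠ p) : fkCoeff β x i k w = 0 := by
  classical
  let moves : Equiv.Perm ℕ → R := fun v => if v p = p then 0 else 1
  have hcomm (s : R) (j : ℕ) (hj : i ≤ j) :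
      Commute (LinearMap.mulLeft R moves) (heckeFactor (simpleHeckeOp β) s j) := by
    have hfix (v : Equiv.Perm ℕ) : moves (v * Equiv.swap j (j + 1)) = moves v := by
      simp only [moves, Equiv.Perm.mul_apply,
        Equiv.swap_apply_of_ne_of_ne (show p ≠ j by omega) (show p ≠ j + 1 by omega)]
    refine LinearMap.ext fun f => funext fun v => ?_
    simp only [Module.End.mul_apply, LinearMap.mulLeft_apply, Pi.mul_apply,
      heckeFactor_simpleHeckeOp_apply, hfix]
    split_ifs <;> ring
  have hdelta : moves * deltaOne (Equiv.Perm ℕ) R = 0 := by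
    funext v
    by_cases hv : v = 1 <;> simp [moves, deltaOne, hv]
  have hmul := congrFun (DFunLike.congr_fun (commute_staircaseProd hcomm x k).eq
    (deltaOne (Equiv.Perm ℕ) R)) w
  simpa [hdelta, moves, hw, fkCoeff] using hmul

theorem diagProd_heckeFactor_apply_eq_zero (β : R) (x : ℕ → R) {i : ℕ} {g : Equiv.Perm ℕ → R}
    (hg : ∀ v : Equiv.Perm ℕ, v i ≠ i → g v = 0) {k q : ℕ} (hq : i + k < q) {w : Equiv.Perm ℕ}
    (hw : w q = i) : diagProd (heckeFactor (simpleHeckeOp β)) x i k g w = 0 := by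
  induction k generalizing w with
  | zero => exact hg w fun h => (by omega : q ≠ i) (w.injective (hw.trans h.symm))
  | succ k ih =>
    have hws : (w * Equiv.swap (i + k) (i + k + 1)) q = i := by
      rw [Equiv.Perm.mul_apply, Equiv.swap_apply_of_ne_of_ne (by omega) (by omega), hw]
    simp only [diagProd, Module.End.mul_apply, heckeFactor_simpleHeckeOp_apply,
      ih (by omega) hw, ih (by omega) hws, mul_zero, add_zero, ite_self]

/-- The value `i` can only be moved to position `i + k` by using the swap of every factor of the
diagonal. -/
theorem diagProd_heckeFactor_apply (β : R) (x : ℕ → R) {i : ℕ} {g : Equiv.Perm ℕ → R}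
    (hg : ∀ v : Equiv.Perm ℕ, v i ≠ i → g v = 0) {k : ℕ} {w : Equiv.Perm ℕ}
    (hfix : ∀ p < i, w p = p) (hw : w (i + k) = i) :
    diagProd (heckeFactor (simpleHeckeOp β)) x i k g w =
      (∏ r ∈ Finset.range k, x r) *
        g (w * diagProd (fun (_ : R) j => Equiv.swap j (j + 1)) x i k) := by
  induction k generalizing w with
  | zero => simp [diagProd]
  | succ k ih =>
    rw [← add_assoc] at hw
    set s := Equiv.swap (i + k) (i + k + 1)
    have hdescent : w (i + k + 1) < w (i + k) := by
      have hne : w (i + k) ≠ i := fun h => by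
        have := w.injective (h.trans hw.symm)
        omega
      by_contra hle
      have := w.injective (hfix (w (i + k)) (by omega))
      omega
    have hs : (w * s) (i + k) = i := by
      rw [Equiv.Perm.mul_apply, Equiv.swap_apply_left, hw]
    have hs_fix (p : ℕ) (hp : p < i) : (w * s) p = p := by
      rw [Equiv.Perm.mul_apply, Equiv.swap_apply_of_ne_of_ne (by omega) (by omega), hfix p hp]
    rw [diagProd, Module.End.mul_apply, heckeFactor_simpleHeckeOp_apply, if_pos hdescent,
      diagProd_heckeFactor_apply_eq_zero β x hg (by omega) hw, ih hs_fix hs,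
      Finset.prod_range_succ, diagProd, mul_assoc w]
    ring

theorem diagProd_swap_apply {P : Type*} (x : ℕ → P) (i k p : ℕ) :
    diagProd (fun (_ : P) j => Equiv.swap j (j + 1)) x i k p =
      if p = i then i + k else if i < p ∧ p ≤ i + k then p - 1 else p := by
  induction k with
  | zero =>
    rw [diagProd, Equiv.Perm.one_apply]
    grind
  | succ k ih =>
    rw [diagProd, Equiv.Perm.mul_apply, ih, Equiv.swap_apply_def]
    grind

theorem fkCoeff_of_antitone (β : R) (x : ℕ → R) {i k : ℕ} {w : Equiv.Perm ℕ}
    (hw : ∀ p, w p = if i ≤ p ∧ p < i + k then 2 * i + k - 1 - p else p) :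
    fkCoeff β x i k w = ∏ r ∈ Finset.range k, x r ^ (k - 1 - r) := by
  induction k generalizing i w with
  | zero =>
    have hw1 : w = 1 := Equiv.ext fun p => by rw [hw, if_neg (by omega), Equiv.Perm.one_apply]
    simp [fkCoeff, staircaseProd, deltaOne, hw1]
  | succ k ih =>
    set c : Equiv.Perm ℕ := diagProd (fun (_ : R) j => Equiv.swap j (j + 1)) x i k
    have hc (p : ℕ) : (w * c) p =
        if i + 1 ≤ p ∧ p < i + 1 + k then 2 * (i + 1) + k - 1 - p else p := by
      rw [Equiv.Perm.mul_apply, diagProd_swap_apply, hw]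
      split_ifs <;> omega
    calc fkCoeff β x i (k + 1) w
        = diagProd (heckeFactor (simpleHeckeOp β)) x i k (fkCoeff β x (i + 1) k) w := by
          rw [fkCoeff, staircaseProd_succ_eq_diagProd_mul (commute_heckeFactor_simpleHeckeOp β)]
          rfl
      _ = (∏ r ∈ Finset.range k, x r) * fkCoeff β x (i + 1) k (w * c) :=
          diagProd_heckeFactor_apply β x
            (fun v hv => fkCoeff_eq_zero_of_apply_ne β x (Nat.lt_succ_self i) k hv)
            (fun p hp => by rw [hw, if_neg (by omega)])
            (by rw [hw, if_pos (by omega)]; omega)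
      _ = ∏ r ∈ Finset.range (k + 1), x r ^ (k - r) := by
          rw [ih hc, Finset.prod_range_succ, Nat.sub_self, pow_zero, mul_one,
            ← Finset.prod_mul_distrib]
          refine Finset.prod_congr rfl fun r hr => ?_
          rw [← pow_succ', show k - 1 - r + 1 = k - r by have := Finset.mem_range.1 hr; omega]

end FominKirillov

section Grothendieck

variable {n : ℕ}

theorem grothendieck_unique {G : Equiv.Perm (Fin n) → PolyRing n}
    (htop : G Fin.revPerm = ∏ i : Fin n, MvPolynomial.X i ^ (n - 1 - (i : ℕ)))
    (hascent : ∀ (w : Equiv.Perm (Fin n)) (i : ℕ) (h : i + 1 < n),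
      w ⟨i, Nat.lt_of_succ_lt h⟩ < w ⟨i + 1, h⟩ →
        G w = isobaric ⟨i, Nat.lt_of_succ_lt h⟩ ⟨i + 1, h⟩ (G (w * simpleSwap i h)))
    (w : Equiv.Perm (Fin n)) : grothendieck w = G w := by
  induction hN : colength w using Nat.strong_induction_on generalizing w with
  | _ N ih =>
    by_cases hw : w = Fin.revPerm
    · rw [grothendieck, dif_pos hw, hw, htop]
    · obtain ⟨i, h, hi⟩ := exists_isAscent hw
      rw [grothendieck_of_isAscent w i h hi, hascent w i h hi,
        ih _ (hN ▸ colength_mul_simpleSwap_lt w i h hi) _ rfl]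

variable (n) in
/-- The embedding of `S_n` in the permutations of `ℕ` that fix every `m ≥ n`. -/
noncomputable abbrev toPermNat : Equiv.Perm (Fin n) →* Equiv.Perm ℕ :=
  Equiv.Perm.viaEmbeddingHom Fin.valEmbedding

theorem toPermNat_apply_of_lt (w : Equiv.Perm (Fin n)) {p : ℕ} (hp : p < n) :
    toPermNat n w p = w ⟨p, hp⟩ :=
  Equiv.Perm.viaEmbedding_apply w Fin.valEmbedding ⟨p, hp⟩

theorem toPermNat_apply_of_le (w : Equiv.Perm (Fin n)) {p : ℕ} (hp : n ≤ p) :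
    toPermNat n w p = p :=
  Equiv.Perm.viaEmbedding_apply_of_notMem w Fin.valEmbedding p fun ⟨q, hq⟩ =>
    hp.not_gt (hq ▸ q.isLt)

theorem toPermNat_simpleSwap (i : ℕ) (h : i + 1 < n) :
    toPermNat n (simpleSwap i h) = Equiv.swap i (i + 1) := by
  ext p
  rcases lt_or_ge p n with hp | hp
  · rw [toPermNat_apply_of_lt _ hp, simpleSwap, Equiv.swap_apply_def, Equiv.swap_apply_def]
    simp only [Fin.ext_iff]
    split_ifs <;> rfl
  · rw [toPermNat_apply_of_le _ hp, Equiv.swap_apply_of_ne_of_ne (by omega) (by omega)]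

variable (n) in
/-- The variables `x_1, …, x_n`, indexed from `0` and followed by the constants `1`, so that all
terms of the sequence specialize to `1` together with the variables. -/
noncomputable def varSeq : ℕ → PolyRing n := Function.extend Fin.val MvPolynomial.X 1

theorem varSeq_of_lt {i : ℕ} (h : i < n) : varSeq n i = MvPolynomial.X ⟨i, h⟩ :=
  Fin.val_injective.extend_apply MvPolynomial.X 1 ⟨i, h⟩

theorem varSeq_of_le {i : ℕ} (h : n ≤ i) : varSeq n i = 1 :=
  Function.extend_apply' _ _ _ fun ⟨j, hj⟩ => h.not_gt (hj ▸ j.isLt)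

theorem act_simpleSwap_varSeq (i : ℕ) (h : i + 1 < n) (j : ℕ) :
    act (simpleSwap i h) (varSeq n j) = varSeq n (Equiv.swap i (i + 1) j) := by
  rw [← toPermNat_simpleSwap i h, act]
  rcases lt_or_ge j n with hj | hj
  · rw [toPermNat_apply_of_lt _ hj, varSeq_of_lt hj, varSeq_of_lt (Fin.isLt _),
      MvPolynomial.rename_X]
  · rw [toPermNat_apply_of_le _ hj, varSeq_of_le hj, map_one]

theorem act_fkCoeff (i : ℕ) (h : i + 1 < n) (w : Equiv.Perm ℕ) :
    act (simpleSwap i h) (fkCoeff (beta n) (varSeq n) 0 n w) =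
      fkCoeff (beta n) (varSeq n ∘ Equiv.swap i (i + 1)) 0 n w := by
  have hbeta : MvPolynomial.rename (simpleSwap i h) (beta n) = beta n :=
    MvPolynomial.rename_C _ _
  have hvars : ⇑(MvPolynomial.rename (simpleSwap i h)) ∘ varSeq n =
      varSeq n ∘ Equiv.swap i (i + 1) := funext (act_simpleSwap_varSeq i h)
  have hmap := map_fkCoeff
    (MvPolynomial.rename (R := Polynomial ℤ) (simpleSwap i h) : PolyRing n →+* PolyRing n)
    (beta n) (varSeq n) 0 n w
  simpa only [act, RingHom.coe_coe, hbeta, hvars] using hmap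

theorem fkCoeff_of_isAscent (w : Equiv.Perm (Fin n)) (i : ℕ) (h : i + 1 < n)
    (hw : w ⟨i, Nat.lt_of_succ_lt h⟩ < w ⟨i + 1, h⟩) :
    fkCoeff (beta n) (varSeq n) 0 n (toPermNat n w) =
      isobaric ⟨i, Nat.lt_of_succ_lt h⟩ ⟨i + 1, h⟩
        (fkCoeff (beta n) (varSeq n) 0 n (toPermNat n (w * simpleSwap i h))) := by
  have hlt : toPermNat n w (0 + i) < toPermNat n w (0 + i + 1) := by
    rw [zero_add, toPermNat_apply_of_lt _ (Nat.lt_of_succ_lt h), toPermNat_apply_of_lt _ h]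
    exact hw
  have hrec := sub_mul_fkCoeff (beta n) (varSeq n) 0 h hlt
  rw [zero_add, varSeq_of_lt h, varSeq_of_lt (Nat.lt_of_succ_lt h), ← act_fkCoeff i h,
    ← toPermNat_simpleSwap i h, ← map_mul] at hrec
  refine mul_left_cancel₀ (X_sub_X_ne (i := ⟨i, Nat.lt_of_succ_lt h⟩) (j := ⟨i + 1, h⟩)
    (by simp)) ?_
  rw [isobaric_spec, hrec, simpleSwap]

theorem grothendieck_eq_fkCoeff (w : Equiv.Perm (Fin n)) :
    grothendieck w = fkCoeff (beta n) (varSeq n) 0 n (toPermNat n w) := by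
  refine grothendieck_unique (G := fun w => fkCoeff (beta n) (varSeq n) 0 n (toPermNat n w))
    ?_ fkCoeff_of_isAscent w
  have hrev (p : ℕ) : toPermNat n Fin.revPerm p =
      if 0 ≤ p ∧ p < 0 + n then 2 * 0 + n - 1 - p else p := by
    rcases lt_or_ge p n with hp | hp
    · rw [toPermNat_apply_of_lt _ hp, if_pos (by omega), Fin.revPerm_apply, Fin.val_rev]
      simp only [mul_zero, zero_add]
      omega
    · rw [toPermNat_apply_of_le _ hp, if_neg (by omega)]
  rw [fkCoeff_of_antitone _ _ hrev, Finset.prod_range]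
  exact Finset.prod_congr rfl fun i _ => by rw [varSeq_of_lt i.isLt]

theorem upsilon_eq_fkCoeff (w : Equiv.Perm (Fin n)) :
    upsilon w = fkCoeff Polynomial.X (fun _ => (1 : Polynomial ℤ)) 0 n (toPermNat n w) := by
  have hbeta : MvPolynomial.eval (fun _ => 1) (beta n) = Polynomial.X := MvPolynomial.eval_C _
  have hvars : ⇑(MvPolynomial.eval fun _ => (1 : Polynomial ℤ)) ∘ varSeq n = fun _ => 1 := by
    funext i
    rcases lt_or_ge i n with hi | hi
    · rw [Function.comp_apply, varSeq_of_lt hi, MvPolynomial.eval_X]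
    · rw [Function.comp_apply, varSeq_of_le hi, map_one]
  rw [upsilon, grothendieck_eq_fkCoeff, map_fkCoeff, hbeta, hvars]

theorem upsilon_inv (w : Equiv.Perm (Fin n)) : upsilon w⁻¹ = upsilon w := by
  rw [upsilon_eq_fkCoeff, upsilon_eq_fkCoeff, map_inv, fkCoeff_inv]

end Grothendieck

section Patterns

variable {m n : ℕ}

/-- The occurrence of `v⁻¹` in `w⁻¹` given by an occurrence `e` of `v` in `w`: its positions are
the values of `w` at the positions `e`. -/
def patternInv (v : Equiv.Perm (Fin m)) (w : Equiv.Perm (Fin n))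
    (e : {e : Fin m ↪o Fin n // ∀ a b : Fin m, v a < v b ↔ w (e a) < w (e b)}) :
    {e : Fin m ↪o Fin n // ∀ a b : Fin m, v⁻¹ a < v⁻¹ b ↔ w⁻¹ (e a) < w⁻¹ (e b)} :=
  ⟨OrderEmbedding.ofStrictMono (fun a => w (e.1 (v⁻¹ a))) fun a b hab =>
      (e.2 _ _).1 (by simpa using hab),
    fun a b => by simp⟩

theorem patternInv_injective (v : Equiv.Perm (Fin m)) (w : Equiv.Perm (Fin n)) :
    Function.Injective (patternInv v w) := fun e e' h => by
  refine Subtype.ext (RelEmbedding.ext fun a => ?_)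
  have hval := DFunLike.congr_fun (congrArg Subtype.val h) (v a)
  simpa [patternInv] using hval

theorem patternCount_le_inv (v : Equiv.Perm (Fin m)) (w : Equiv.Perm (Fin n)) :
    patternCount v w ≤ patternCount v⁻¹ w⁻¹ :=
  Nat.card_le_card_of_injective _ (patternInv_injective v w)

theorem patternCount_inv (v : Equiv.Perm (Fin m)) (w : Equiv.Perm (Fin n)) :
    patternCount v⁻¹ w⁻¹ = patternCount v w :=
  le_antisymm (by simpa only [inv_inv] using patternCount_le_inv v⁻¹ w⁻¹)
    (patternCount_le_inv v w)

end Patterns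

end GrothendieckSpecialization

theorem mainTheorem6 (n : ℕ) (w : Equiv.Perm (Fin n)) :
    GrothendieckSpecialization.patternCoeff w = GrothendieckSpecialization.patternCoeff w⁻¹ := by
  induction n using Nat.strong_induction_on with
  | _ n ih =>
    cases n with
    | zero => rw [Subsingleton.elim w⁻¹ w]
    | succ n =>
      rw [GrothendieckSpecialization.patternCoeff, GrothendieckSpecialization.patternCoeff,
        GrothendieckSpecialization.upsilon_inv]
      congr 1
      refine Finset.sum_congr rfl fun m _ => ?_
      rw [← Equiv.sum_comp (Equiv.inv (Equiv.Perm (Fin m)))]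
      refine Finset.sum_congr rfl fun v _ => ?_
      rw [Equiv.inv_apply, ← ih m m.isLt v, ← GrothendieckSpecialization.patternCount_inv v⁻¹ w,
        inv_inv]
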